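/- Throughout, "ultrafilter" means non-principal ultrafilter, and for posets smaller conditions are stronger. **Ultrafilter limits.** Let $D$ be an ultrafilter on $\omega$, $\mathbb{P}$ a poset and $Q\subseteq\mathbb{P}$. A function $\lim^D\colon Q^\omega\to\mathbb{P}$ *witnesses that $Q$ is $D$-lim-linked* if there is a $\mathbb{P}$-name $\dot D'$ of an ultrafilter on $\omega$ extending $D$ such that $\lim^D\bar q\Vdash\{m<\omega: q_m\in\dot G\}\in\dot D'$ for every $\bar q=\langle q_m:m<\omega\rangle\in Q^\omega$. $Q$ is *closed-$D$-lim-linked* if some witness has range included in $Q$, and *closed-ultrafilter-limit-linked* ($Q\in\Lambda^{\mathrm{lim}}_{\mathrm{cuf}}(\mathbb{P})$) if it is closed-$D$-lim-linked for every ultrafilter $D$ on $\omega$. $\mathbb{P}$ is $\sigma$-$\Lambda^{\mathrm{lim}}_{\mathrm{cuf}}$-linked if it is a union of at most countably many subsets in $\Lambda^{\mathrm{lim}}_{\mathrm{cuf}}(\mathbb{P})$. For $n<\omega$, $(\star)_n$ for $\lim^D$ is the statement: whenever $\bar q^j=\langle q^j_m:m<\omega\rangle\in Q^\omega$ for $j<n$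 and $r\in\mathbb{P}$ satisfies $r\le\lim^D\bar q^j$ for all $j<n$, then $\{m<\omega: r\text{ and all }q^j_m\ (j<n)\text{ have a common extension}\}\in D$. **The poset $\widetilde{\mathbb{E}}$.** Define a tree $T^*\subseteq\omega^{<\omega}$ by induction on the height $h$: $\langle\rangle\in T^*$; put $\rho(h)=\max\{|T^*\cap\omega^h|,h+2\}$, $\pi(h)=((h+1)^2\rho(h)^{h+1})^{\rho(h)^h}$, $a(h)=\pi(h)^{h+2}$, $M(h)=a(h)^2$; and the immediate successors of $s\in T^*\cap\omega^h$ in $T^*$ are $s^\frown l$, $l<M(h)$. Put $\mu_h(n)=\log_{a(h)}\frac{M(h)}{M(h)-n}$ for $n<M(h)$ and $\mu_h(M(h))=\infty$. For a (non-empty) subtree $p\subseteq T^*$ and $s\in p$ let $\mu_s(p)=\mu_{|s|}(n)$, where $n$ is the number of immediate successors of $s$ in $p$; $\mathrm{stem}(p)$ is the smallest splitting node of $p$. $\widetilde{\mathbb{E}}$ is the set of all subtrees $p\subseteq T^*$ that have a stem and satisfy $\mu_s(p)\ge1+\frac1{|\mathrm{stem}(p)|}$ (with $\frac10=\infty$)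 for all $s\in p$ with $s\supseteq\mathrm{stem}(p)$, ordered by $p\le q:\Leftrightarrow p\subseteq q$. For $t\in T^*$ and rational $\varepsilon\in(0,1)$, $Q_{t,\varepsilon}$ is the set of all $p\in\widetilde{\mathbb{E}}$ for which there is a natural number $m\ge2$ such that $\mathrm{stem}(p)=t$, $|t|>3m$, $\mu_s(p)\ge1+\frac1m$ for all $s\in p$ with $s\supseteq t$, and $\frac1m\le\varepsilon$. **Lemma.** Let $t\in T^*$, let $\varepsilon\in(0,1)$ be rational, and let $Q=Q_{t,\varepsilon}$. Then $Q\subseteq\widetilde{\mathbb{E}}$ is closed-ultrafilter-limit-linked. Moreover, for every ultrafilter $D$ on $\omega$ and every $\bar q=\langle q_m:m<\omega\rangle\in Q^\omega$, the set $\lim^D\bar q:=\{s\in T^*:\{m<\omega:s\in q_m\}\in D\}$ is an element of $Q$; the function $\lim^D\colon Q^\omega\to Q$ so defined satisfies $(\star)_n$ for all $n<\omega$ and witnesses that $Q$ is closed-$D$-lim-linked. Finally, $\widetilde{\mathbb{E}}$ is $\sigma$-$\Lambda^{\mathrm{lim}}_{\mathrm{cuf}}$-linked. -/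

import Mathlib

open scoped ENNReal

universe u

/-! ## Names and the forcing relation -/

/-- `P`-names: a name is a (small) family of pairs consisting of a `P`-name and a condition. -/
inductive PName (P : Type u) : Type (u + 1)
  | mk (ι : Type u) (elem : ι → PName P) (cond : ι → P) : PName P

/-- A sentence of the forcing language, identified with the set of conditions forcing it.
Stronger conditions are smaller. -/
abbrev FSentence (P : Type u) : Type u := P → Prop

namespace PName

variable {P : Type u}

/-- The check name of a ground-model set: `x̌ = {(y̌, p) : y ∈ x, p ∈ P}`
(so that no greatest condition is needed). -/
def check (P : Type u) : PSet.{u} → PName P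
  | PSet.mk α A => mk (α × P) (fun i => check P (A i.1)) (fun i => i.2)

section Atomic

variable [Preorder P]

/-- `p ⊩ x = y`: for every `(a, c) ∈ x`, every `q ≤ p, c` has an extension `r` such that, for some
`(b, d) ∈ y`, `r ≤ d` and `r ⊩ a = b`; and symmetrically. -/
def eq : PName P → PName P → FSentence P
  | mk ι a c, mk κ b d => fun p =>
      (∀ i : ι, ∀ q ≤ p, q ≤ c i → ∃ r ≤ q, ∃ j : κ, r ≤ d j ∧ eq (a i) (b j) r) ∧
      (∀ j : κ, ∀ q ≤ p, q ≤ d j → ∃ r ≤ q, ∃ i : ι, r ≤ c i ∧ eq (a i) (b j) r)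

/-- `p ⊩ x ∈ y`: the conditions `r` such that `r ≤ d` and `r ⊩ x = b` for some `(b, d) ∈ y`
are dense below `p`. -/
def mem (x : PName P) : PName P → FSentence P
  | mk κ b d => fun p => ∀ q ≤ p, ∃ r ≤ q, ∃ j : κ, r ≤ d j ∧ eq x (b j) r

end Atomic

end PName

namespace FSentence

variable {P : Type u}

/-- Conjunction. -/
def and (φ ψ : FSentence P) : FSentence P := fun p => φ p ∧ ψ p

/-- Universal quantification over all `P`-names. -/
def all (φ : PName P → FSentence P) : FSentence P := fun p => ∀ x, φ x p

section Connectives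

variable [Preorder P]

/-- Negation. -/
def not (φ : FSentence P) : FSentence P := fun p => ∀ q ≤ p, ¬ φ q

/-- Disjunction. -/
def or (φ ψ : FSentence P) : FSentence P := fun p => ∀ q ≤ p, ∃ r ≤ q, φ r ∨ ψ r

/-- Implication. -/
def imp (φ ψ : FSentence P) : FSentence P := fun p => ∀ q ≤ p, φ q → ψ q

/-- Equivalence. -/
def iff (φ ψ : FSentence P) : FSentence P := and (imp φ ψ) (imp ψ φ)

/-- `x ⊆ y`. -/
def sub (x y : PName P) : FSentence P := all fun z => imp (z.mem x) (z.mem y)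

end Connectives

end FSentence

/-- A set of natural numbers as a ground-model set (of von Neumann numerals). -/
def natPSet (X : Set ℕ) : PSet.{u} := PSet.mk (ULift.{u} X) fun n => PSet.ofNat n.down.1

/-- A family of sets of natural numbers as a ground-model set. -/
def famPSet (F : Set (Set ℕ)) : PSet.{u} := PSet.mk (ULift.{u} F) fun X => natPSet X.down.1

/-- The check name of the set of natural numbers. -/
def omegaName (P : Type u) : PName P := PName.check P (natPSet Set.univ)

/-- The `P`-name `{(m̌, q m) : m < ω}` of the set `{m < ω : q m ∈ Ġ}`. -/
def indexName {P : Type u} (q : ℕ → P) : PName P :=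
  PName.mk (ULift.{u} ℕ) (fun m => PName.check P (PSet.ofNat m.down)) (fun m => q m.down)

section UltrafilterNames

variable {P : Type u} [Preorder P]

open FSentence in
/-- The sentence "`U` is a non-principal ultrafilter on `ω`". -/
def isUltrafilterSentence (U : PName P) : FSentence P :=
  -- every member is a subset of `ω`
  and (all fun x => imp (x.mem U) (sub x (omegaName P))) <|
  -- `ω` is a member, the empty set is not
  and ((omegaName P).mem U) <|
  and (not ((PName.check P ∅).mem U)) <|
  -- closed under supersets
  and (all fun x => all fun y =>
    imp (x.mem U) (imp (sub x y) (imp (sub y (omegaName P)) (y.mem U)))) <|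
  -- closed under intersections
  and (all fun x => all fun y => all fun z =>
    imp (x.mem U) (imp (y.mem U)
      (imp (all fun w => iff (w.mem z) (and (w.mem x) (w.mem y))) (z.mem U)))) <|
  -- contains each subset of `ω` or its complement
  and (all fun x => all fun y =>
    imp (sub x (omegaName P))
      (imp (all fun w => iff (w.mem y) (and (w.mem (omegaName P)) (not (w.mem x))))
        (or (x.mem U) (y.mem U)))) <|
  -- contains no singleton
  all fun n => all fun x =>
    imp (n.mem (omegaName P)) (imp (all fun w => iff (w.mem x) (w.eq n)) (not (x.mem U)))

/-- The `P`-name `U` is forced by every condition to be a non-principal ultrafilter on `ω`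
extending `D`. -/
def IsUltrafilterNameExtending (D : Ultrafilter ℕ) (U : PName P) : Prop :=
  ∀ p : P, isUltrafilterSentence U p ∧
    FSentence.sub (PName.check P (famPSet {X | X ∈ D})) U p

end UltrafilterNames

/-! ## Closed-ultrafilter-limit-linkedness -/

/-- Non-principal ultrafilters on `ω`. -/
def IsNonprincipal (D : Ultrafilter ℕ) : Prop := ∀ n : ℕ, ({n} : Set ℕ) ∉ D

section Limits

variable {P : Type u} [PartialOrder P]

/-- `lim : Q^ω → P` witnesses that `Q ⊆ P` is `D`-lim-linked: for some `P`-name `D'` of an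
ultrafilter extending `D`, `lim q ⊩ {m < ω : q m ∈ Ġ} ∈ D'` for all `q ∈ Q^ω`. -/
def WitnessesLimLinked (D : Ultrafilter ℕ) (Q : Set P) (lim : (ℕ → Q) → P) : Prop :=
  ∃ D' : PName P, IsUltrafilterNameExtending D D' ∧
    ∀ q : ℕ → Q, (indexName fun m => (q m : P)).mem D' (lim q)

/-- The combinatorial condition `(⋆)_n` for `lim : Q^ω → P`. -/
def StarCondition (D : Ultrafilter ℕ) (Q : Set P) (lim : (ℕ → Q) → P) (n : ℕ) : Prop :=
  ∀ (q : Fin n → ℕ → Q) (r : P), (∀ j, r ≤ lim (q j)) →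
    {m : ℕ | ∃ e : P, e ≤ r ∧ ∀ j, e ≤ (q j m : P)} ∈ D

end Limits

/-- A class for subsets of posets. -/
abbrev PosetSubsetClass : Type (u + 1) := ∀ (P : Type u) [PartialOrder P], Set (Set P)

/-- The closed-`D`-lim-linked subsets. -/
def lambdaLimClosed (D : Ultrafilter ℕ) : PosetSubsetClass.{u} := fun P _ =>
  {Q | ∃ lim : (ℕ → Q) → P, WitnessesLimLinked D Q lim ∧ Set.range lim ⊆ Q}

/-- The closed-ultrafilter-limit-linked subsets. -/
def lambdaLimCuf : PosetSubsetClass.{u} := fun P _ =>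
  {Q | ∀ D : Ultrafilter ℕ, IsNonprincipal D → Q ∈ lambdaLimClosed D P}

/-- `P` is `μ`-`Γ`-linked: a union of at most `μ` many subsets in `Γ(P)`. -/
def IsClassLinked (μ : Cardinal.{u}) (Γ : PosetSubsetClass.{u}) (P : Type u) [PartialOrder P] :
    Prop :=
  ∃ S : Set (Set P), Cardinal.mk S ≤ μ ∧ (∀ Q ∈ S, Q ∈ Γ P) ∧ ⋃₀ S = Set.univ

/-! ## The poset `Ẽ` -/

namespace ETilde

/-- `ρ(h)` as a function of `h` and of the number `N` of nodes at height `h`. -/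
def rhoAux (N h : ℕ) : ℕ := max N (h + 2)

/-- `π(h)`, likewise. -/
def piAux (N h : ℕ) : ℕ := ((h + 1) ^ 2 * rhoAux N h ^ (h + 1)) ^ (rhoAux N h ^ h)

/-- `a(h)`, likewise. -/
def aAux (N h : ℕ) : ℕ := piAux N h ^ (h + 2)

/-- `M(h)`, likewise. -/
def MAux (N h : ℕ) : ℕ := aAux N h ^ 2

/-- `T* ∩ ω^h`: each node at height `h` has the immediate successors `s⌢l`, `l < M(h)`. -/
def level : ℕ → Finset (List ℕ)
  | 0 => {[]}
  | h + 1 => (level h).biUnion fun s =>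
      (Finset.range (MAux (level h).card h)).image fun l => s ++ [l]

/-- The tree `T*`. -/
def Tstar : Set (List ℕ) := {s | s ∈ level s.length}

/-- `a(h)`. -/
def a (h : ℕ) : ℕ := aAux (level h).card h

/-- `M(h)`. -/
def M (h : ℕ) : ℕ := MAux (level h).card h

/-- `μ_h(n) = log_{a(h)} (M(h) / (M(h) - n))` for `n < M(h)`, and `μ_h(M(h)) = ∞`. -/
noncomputable def muHeight (h n : ℕ) : ℝ≥0∞ :=
  if n < M h then ENNReal.ofReal (Real.logb (a h) ((M h : ℝ) / ((M h : ℝ) - n))) else ⊤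

/-- The set of immediate successors of `s` in `p`. -/
def succs (p : Set (List ℕ)) (s : List ℕ) : Set (List ℕ) := {s' ∈ p | ∃ l : ℕ, s' = s ++ [l]}

/-- `μ_s(p)`. -/
noncomputable def mu (s : List ℕ) (p : Set (List ℕ)) : ℝ≥0∞ :=
  muHeight s.length (succs p s).ncard

/-- `p` is a subtree of `T*`: a non-empty subset closed under initial segments. -/
def IsSubtree (p : Set (List ℕ)) : Prop :=
  p ⊆ Tstar ∧ p.Nonempty ∧ ∀ s ∈ p, ∀ t, t <+: s → t ∈ p

/-- `s` is a splitting node of `p`: it has at least two immediate successors. -/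
def IsSplitting (p : Set (List ℕ)) (s : List ℕ) : Prop := s ∈ p ∧ (succs p s).Nontrivial

/-- `t` is the stem of `p`: the smallest splitting node. -/
def IsStem (p : Set (List ℕ)) (t : List ℕ) : Prop :=
  IsSplitting p t ∧ ∀ s, IsSplitting p s → t <+: s

/-- `p` is a condition of `Ẽ`: a subtree of `T*` with a stem, all of whose nodes `s` above the stem
satisfy `μ_s(p) ≥ 1 + 1 / |stem(p)|` (where `1 / 0 = ∞`). -/
def IsCondition (p : Set (List ℕ)) : Prop :=
  IsSubtree p ∧ ∃ t, IsStem p t ∧ ∀ s ∈ p, t <+: s → 1 + (t.length : ℝ≥0∞)⁻¹ ≤ mu s p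

end ETilde

/-- The poset `Ẽ`, ordered by inclusion. -/
abbrev ETilde : Type := {p : Set (List ℕ) // ETilde.IsCondition p}

namespace ETilde

/-- The component `Q_{t,ε}` of `Ẽ`. -/
def component (t : List ℕ) (ε : ℚ) : Set ETilde :=
  {p | ∃ m : ℕ, 2 ≤ m ∧ (IsStem p.1 t ∧ 3 * m < t.length) ∧
    (∀ s ∈ p.1, t <+: s → 1 + (m : ℝ≥0∞)⁻¹ ≤ mu s p.1) ∧ 1 / (m : ℚ) ≤ ε}

/-- The tree `{t ∈ T* : {m < ω : t ∈ q m} ∈ D}`. -/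
def limitTree (D : Ultrafilter ℕ) (q : ℕ → ETilde) : Set (List ℕ) :=
  {t ∈ Tstar | {m : ℕ | t ∈ (q m).1} ∈ D}

end ETilde

/-! The limit tree stays in the component because `Tstar` is finitely branching: at each node $s$,
for $D$-many $m$, the limit and $q_m$ have the same immediate successors, so the stem and the norm
bounds pass to the limit.

For $(\star)_n$ let $r$ lie below the limits of $n$ sequences and take $s_1\in r$ far above the stem
of $r$. As $s_1$ lies in every limit, for $D$-many $m$ it lies in all $q^j_m$. Intersecting these
$n+1$ trees adds up the numbers of missing successors. A bound $1+\frac1l$ for each tree leaves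
$1+\frac1{2l}$ for the intersection once $(n+1)^{2l}\le a(h)$, so above $s_1$ the intersection is a
condition if $s_1$ is long enough (`one_add_inv_le_mu_iInter`, `starCondition_limit`).

The name of the ultrafilter is built from $(\star)_n$ for all $n$, without a generic extension. A
family of subsets of $\omega$ in the extension is coded by a map $F$ from sequences of lower sets of
$P$ to lower sets of $P$. The set $D$ and the sets $\{m: q_m\in\dot G\}$ with $\lim^D\bar q\in\dot
G$ generate a valued filter, and $(\star)_n$ says exactly that it is proper. Zorn's lemma extends it
to a valued ultrafilter, which is read back as a name.

For $\sigma$-linkedness, the components with $\varepsilon=\frac12$ do not cover $\widetilde{\mathbb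
E}$, but their union is dense and upward closure preserves linkedness. -/

namespace PName

variable {P : Type u}

/-! ### Forcing equality and membership -/

section Atomic

variable [Preorder P] {x y z : PName P} {p q : P}

theorem eq_mono (h : x.eq y p) (hq : q ≤ p) : x.eq y q := by
  cases x; cases y
  exact ⟨fun i r hr => h.1 i r (hr.trans hq), fun j r hr => h.2 j r (hr.trans hq)⟩

theorem eq_refl (x : PName P) (p : P) : x.eq x p := by
  induction x generalizing p with
  | mk ι a c ih => exact ⟨fun i q _ hc => ⟨q, le_rfl, i, hc, ih i q⟩,
      fun i q _ hc => ⟨q, le_rfl, i, hc, ih i q⟩⟩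

theorem eq_symm (h : x.eq y p) : y.eq x p := by
  induction x generalizing y p with
  | mk ι a c ih =>
    cases y
    refine ⟨fun j q hq hc => ?_, fun i q hq hc => ?_⟩
    · obtain ⟨r, hr, i, hi, he⟩ := h.2 j q hq hc
      exact ⟨r, hr, i, hi, ih i he⟩
    · obtain ⟨r, hr, j, hj, he⟩ := h.1 i q hq hc
      exact ⟨r, hr, j, hj, ih i he⟩

theorem eq_trans (h : x.eq y p) (h' : y.eq z p) : x.eq z p := by
  induction x generalizing y z p with
  | mk ι a c ih =>
    cases y; cases z
    refine ⟨fun i q hq hc => ?_, fun k q hq hc => ?_⟩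
    · obtain ⟨r, hr, j, hj, he⟩ := h.1 i q hq hc
      obtain ⟨s, hs, k, hk, he'⟩ := h'.1 j r (hr.trans hq) hj
      exact ⟨s, hs.trans hr, k, hk, ih i (eq_mono he hs) he'⟩
    · obtain ⟨r, hr, j, hj, he⟩ := h'.2 k q hq hc
      obtain ⟨s, hs, i, hi, he'⟩ := h.2 j r (hr.trans hq) hj
      exact ⟨s, hs.trans hr, i, hi, ih i he' (eq_mono he hs)⟩

theorem mem_mono (h : x.mem y p) (hq : q ≤ p) : x.mem y q := by
  cases y
  exact fun r hr => h r (hr.trans hq)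

theorem mem_of_dense (h : ∀ q ≤ p, ∃ r ≤ q, x.mem y r) : x.mem y p := by
  cases y
  intro q hq
  obtain ⟨r, hr, hm⟩ := h q hq
  obtain ⟨s, hs, hj⟩ := hm r le_rfl
  exact ⟨s, hs.trans hr, hj⟩

theorem mem_congr_left (h : x.eq y p) (hm : x.mem z p) : y.mem z p := by
  cases z
  intro q hq
  obtain ⟨r, hr, j, hj, he⟩ := hm q hq
  exact ⟨r, hr, j, hj, eq_trans (eq_symm (eq_mono h (hr.trans hq))) he⟩

theorem mem_congr_right (h : x.eq y p) (hm : z.mem x p) : z.mem y p := by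
  cases x; cases y
  intro q hq
  obtain ⟨r, hr, i, hi, he⟩ := hm q hq
  obtain ⟨s, hs, j, hj, he'⟩ := h.1 i r (hr.trans hq) hi
  exact ⟨s, hs.trans hr, j, hj, eq_trans (eq_mono he hs) he'⟩

/-- Extensionality only has to be tested on the names listed in `x` and `y`: below its own
condition, each of them is forced into the name that lists it. -/
theorem eq_of_mem_iff (h : ∀ z : PName P, ∀ q ≤ p, z.mem x q ↔ z.mem y q) : x.eq y p := by
  cases x with | mk ι a c
  cases y with | mk κ b d
  refine ⟨fun i q hq hc => ?_, fun j q hq hd => ?_⟩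
  · exact (h (a i) q hq).1 (fun r hr => ⟨r, le_rfl, i, hr.trans hc, eq_refl _ _⟩) q le_rfl
  · obtain ⟨r, hr, i, hi, he⟩ :=
      (h (b j) q hq).2 (fun r hr => ⟨r, le_rfl, j, hr.trans hd, eq_refl _ _⟩) q le_rfl
    exact ⟨r, hr, i, hi, eq_symm he⟩

/-- The Boolean value of `n ∈ x`, as a lower set, for each natural number `n`. -/
def val (x : PName P) (n : ℕ) : LowerSet P :=
  ⟨{p | (check P (PSet.ofNat n)).mem x p}, fun _ _ hq hp => mem_mono hp hq⟩

theorem mem_val {n : ℕ} : p ∈ x.val n ↔ (check P (PSet.ofNat n)).mem x p := Iff.rfl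

/-- A check name pairs each element with every condition, so `p` itself can serve as the attached
condition and ∈-induction runs in the ground model. -/
theorem equiv_of_eq_check {s t : PSet.{u}} (h : (check P s).eq (check P t) p) : s.Equiv t := by
  induction s generalizing t p with
  | mk α A ih =>
    cases t
    refine ⟨fun i => ?_, fun j => ?_⟩
    · obtain ⟨r, -, j, -, he⟩ := h.1 (i, p) p le_rfl le_rfl
      exact ⟨j.1, ih i he⟩
    · obtain ⟨r, -, i, -, he⟩ := h.2 (j, p) p le_rfl le_rfl
      exact ⟨i.1, ih i.1 he⟩

end Atomic

theorem _root_.PSet.ofNat_mem_ofNat {m n : ℕ} (h : m < n) :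
    PSet.ofNat.{u} m ∈ PSet.ofNat.{u} n := by
  induction n with
  | zero => omega
  | succ n ih =>
    rw [PSet.ofNat, PSet.mem_insert_iff]
    rcases Nat.lt_succ_iff_lt_or_eq.1 h with h | rfl
    · exact Or.inr (ih h)
    · exact Or.inl (PSet.Equiv.refl _)

theorem _root_.PSet.ofNat_equiv_iff {m n : ℕ} :
    (PSet.ofNat.{u} m).Equiv (PSet.ofNat.{u} n) ↔ m = n := by
  refine ⟨fun h => ?_, fun h => h ▸ PSet.Equiv.refl _⟩
  by_contra hne
  rcases lt_or_gt_of_ne hne with hlt | hlt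
  · exact PSet.mem_irrefl _ ((PSet.Mem.congr_right h).2 (PSet.ofNat_mem_ofNat hlt))
  · exact PSet.mem_irrefl _ ((PSet.Mem.congr_right h).1 (PSet.ofNat_mem_ofNat hlt))

/-! ### Names for subsets of ω -/

variable [Preorder P] {x y z : PName P} {p q : P}

theorem mem_check_natPSet {X : Set ℕ} : z.mem (check P (natPSet X)) p ↔
    ∀ q ≤ p, ∃ r ≤ q, ∃ n ∈ X, z.eq (check P (PSet.ofNat n)) r := by
  refine forall₂_congr fun q _ => exists_congr fun r => and_congr_right fun hr => ?_
  constructor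
  · rintro ⟨⟨⟨n, hn⟩, c⟩, hc, he⟩
    exact ⟨n, hn, he⟩
  · rintro ⟨n, hn, he⟩
    exact ⟨⟨⟨n, hn⟩, r⟩, le_rfl, he⟩

theorem mem_omegaName : z.mem (omegaName P) p ↔
    ∀ q ≤ p, ∃ r ≤ q, ∃ n, z.eq (check P (PSet.ofNat n)) r := by
  rw [omegaName, mem_check_natPSet]
  simp

theorem numeral_mem_check_natPSet {X : Set ℕ} {n : ℕ} (hn : n ∈ X) :
    (check P (PSet.ofNat n)).mem (check P (natPSet X)) p :=
  mem_check_natPSet.2 fun q _ => ⟨q, le_rfl, n, hn, eq_refl _ _⟩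

theorem check_natPSet_sub_omegaName (X : Set ℕ) (p : P) :
    FSentence.sub (check P (natPSet X)) (omegaName P) p := by
  intro z q _ hz
  rw [mem_check_natPSet] at hz
  rw [mem_omegaName]
  intro r hr
  obtain ⟨s, hs, n, -, he⟩ := hz r hr
  exact ⟨s, hs, n, he⟩

/-- The name of the subset of `ω` whose value at `n` is generated by `σ n`. -/
def nice (σ : ℕ → LowerSet P) : PName P :=
  mk (Σ n : ℕ, σ n) (fun i => check P (PSet.ofNat i.1)) (fun i => i.2)

theorem mem_nice {σ : ℕ → LowerSet P} : z.mem (nice σ) p ↔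
    ∀ q ≤ p, ∃ r ≤ q, ∃ n, r ∈ σ n ∧ z.eq (check P (PSet.ofNat n)) r := by
  refine forall₂_congr fun q _ => exists_congr fun r => and_congr_right fun hr => ?_
  constructor
  · rintro ⟨⟨n, c⟩, hc, he⟩
    exact ⟨n, (σ n).lower hc c.2, he⟩
  · rintro ⟨n, hn, he⟩
    exact ⟨⟨n, ⟨r, hn⟩⟩, le_rfl, he⟩

theorem mem_indexName {f : ℕ → P} : z.mem (indexName f) p ↔
    ∀ q ≤ p, ∃ r ≤ q, ∃ n, r ≤ f n ∧ z.eq (check P (PSet.ofNat n)) r := by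
  refine forall₂_congr fun q _ => exists_congr fun r => and_congr_right fun hr => ?_
  exact ⟨fun ⟨n, h⟩ => ⟨n.down, h⟩, fun ⟨n, h⟩ => ⟨⟨n⟩, h⟩⟩

theorem indexName_sub_omegaName (f : ℕ → P) (p : P) :
    FSentence.sub (indexName f) (omegaName P) p := by
  intro z q _ hz
  rw [mem_indexName] at hz
  rw [mem_omegaName]
  intro r hr
  obtain ⟨s, hs, n, -, he⟩ := hz r hr
  exact ⟨s, hs, n, he⟩

theorem sub_mono (h : FSentence.sub x y p) (hq : q ≤ p) : FSentence.sub x y q :=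
  fun z r hr => h z r (hr.trans hq)

theorem sub_of_dense (h : ∀ q ≤ p, ∃ r ≤ q, FSentence.sub x y r) : FSentence.sub x y p := by
  intro z q hq hz
  refine mem_of_dense fun r hr => ?_
  obtain ⟨s, hs, hsub⟩ := h r (hr.trans hq)
  exact ⟨s, hs, hsub z s le_rfl (mem_mono hz (hs.trans hr))⟩

/-- Below a condition forcing `x ⊆ ω`, membership in `x` is decided by the values of `x`. -/
theorem mem_iff_of_sub_omegaName (h : FSentence.sub x (omegaName P) p) : z.mem x p ↔
    ∀ q ≤ p, ∃ r ≤ q, ∃ n, r ∈ x.val n ∧ z.eq (check P (PSet.ofNat n)) r := by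
  constructor
  · intro hz q hq
    obtain ⟨r, hr, n, he⟩ := mem_omegaName.1 (h z p le_rfl hz) q hq
    exact ⟨r, hr, n, mem_congr_left he (mem_mono hz (hr.trans hq)), he⟩
  · intro hz
    refine mem_of_dense fun q hq => ?_
    obtain ⟨r, hr, n, hn, he⟩ := hz q hq
    exact ⟨r, hr, mem_congr_left (eq_symm he) hn⟩

/-- This is why a small name can list all subsets of ω in the extension: the nice names, indexed by
sequences of lower sets, suffice. -/
theorem eq_nice_val (h : FSentence.sub x (omegaName P) p) : x.eq (nice x.val) p :=
  eq_of_mem_iff fun _ _ hq => by rw [mem_iff_of_sub_omegaName (sub_mono h hq), mem_nice]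

theorem nice_sub_omegaName (σ : ℕ → LowerSet P) (p : P) :
    FSentence.sub (nice σ) (omegaName P) p := by
  intro z q _ hz
  rw [mem_nice] at hz
  rw [mem_omegaName]
  intro r hr
  obtain ⟨s, hs, n, -, he⟩ := hz r hr
  exact ⟨s, hs, n, he⟩

/-- Only an inequality is available: `σ n` is an arbitrary lower set, while the values of a name are
closed under density below a condition. -/
theorem le_val_nice (σ : ℕ → LowerSet P) : σ ≤ (nice σ).val := fun n _ hq =>
  mem_nice.2 fun r hr => ⟨r, le_rfl, n, (σ n).lower hr hq, eq_refl _ _⟩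

end PName

/-! ### Valued filters and ultrafilters -/

/-- `F` is a filter of sequences with truth values in the frame `L`: seen as an `L`-valued
family of `L`-valued subsets of `ℕ`, it is a proper filter. -/
structure IsValuedFilter {L : Type u} [Order.Frame L] (F : (ℕ → L) → L) : Prop where
  mono : Monotone F
  inf_le : ∀ x y, F x ⊓ F y ≤ F (x ⊓ y)
  le_const : ∀ b, b ≤ F fun _ => b
  bot_eq : F ⊥ = ⊥

namespace IsValuedFilter

section Frame

variable {L : Type u} [Order.Frame L] {F : (ℕ → L) → L}

theorem compl_compl (hF : IsValuedFilter F) : IsValuedFilter fun x => (F x)ᶜᶜ where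
  mono _ _ h := compl_le_compl (compl_le_compl (hF.mono h))
  inf_le x y := by
    rw [← compl_compl_inf_distrib]
    exact compl_le_compl (compl_le_compl (hF.inf_le x y))
  le_const b := (hF.le_const b).trans le_compl_compl
  bot_eq := by simp [hF.bot_eq]

/-- Adding `x` to the filter, with the largest truth value that keeps the filter proper. -/
theorem adjoin (hF : IsValuedFilter F) (x : ℕ → L) :
    IsValuedFilter fun y => F y ⊔ ((F xᶜ)ᶜ ⊓ F (x ⇨ y)) where
  mono _ _ h := sup_le_sup (hF.mono h) (inf_le_inf_left _ (hF.mono (himp_le_himp_left h)))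
  inf_le y z := by
    have key : F (x ⇨ y) ⊓ F (x ⇨ z) ≤ F (x ⇨ y ⊓ z) := by
      rw [himp_inf_distrib]
      exact hF.inf_le _ _
    have hy : F y ≤ F (x ⇨ y) := hF.mono le_himp
    have hz : F z ≤ F (x ⇨ z) := hF.mono le_himp
    rw [inf_sup_right, inf_sup_left, inf_sup_left]
    refine sup_le (sup_le ?_ ?_) (sup_le ?_ ?_)
    · exact le_sup_of_le_left (hF.inf_le _ _)
    · refine le_sup_of_le_right (le_inf (inf_le_right.trans inf_le_left) (le_trans ?_ key))
      exact inf_le_inf hy inf_le_right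
    · refine le_sup_of_le_right (le_inf (inf_le_left.trans inf_le_left) (le_trans ?_ key))
      exact inf_le_inf inf_le_right hz
    · refine le_sup_of_le_right (le_inf (inf_le_left.trans inf_le_left) (le_trans ?_ key))
      exact inf_le_inf inf_le_right inf_le_right
  le_const b := le_sup_of_le_left (hF.le_const b)
  bot_eq := by
    -- Since `x ⇨ ⊥ = xᶜ`, the factor `(F xᶜ)ᶜ` is just what cancels the value of the enlarged
    -- filter at `⊥`.
    rw [hF.bot_eq, himp_bot, compl_inf_self, sup_idem]

theorem sSup_chain {c : Set ((ℕ → L) → L)} (hne : c.Nonempty) (hc : IsChain (· ≤ ·) c)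
    (h : ∀ F ∈ c, IsValuedFilter F) : IsValuedFilter (sSup c) where
  mono x y hxy := by
    rw [sSup_apply, sSup_apply]
    exact iSup_le fun G => (((h _ G.2).mono hxy)).trans (le_iSup (fun G : c => G.1 y) G)
  inf_le x y := by
    rw [sSup_apply, sSup_apply, sSup_apply, iSup_inf_iSup]
    refine iSup_le fun ⟨G, H⟩ => ?_
    rcases hc.total G.2 H.2 with hGH | hGH
    · exact (inf_le_inf_right _ (hGH x)).trans (((h _ H.2).inf_le x y).trans
        (le_iSup (fun G : c => G.1 (x ⊓ y)) H))
    · exact (inf_le_inf_left _ (hGH y)).trans (((h _ G.2).inf_le x y).trans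
        (le_iSup (fun G : c => G.1 (x ⊓ y)) G))
  le_const b := by
    obtain ⟨G, hG⟩ := hne
    rw [sSup_apply]
    exact ((h G hG).le_const b).trans (le_iSup (fun G : c => G.1 fun _ => b) ⟨G, hG⟩)
  bot_eq := by
    rw [sSup_apply]
    simp only [iSup_eq_bot]
    exact fun G => (h _ G.2).bot_eq

/-- Every valued filter extends to a regular one which is an ultrafilter. -/
theorem exists_ultra (hF : IsValuedFilter F) : ∃ G, F ≤ G ∧ IsValuedFilter G ∧
    (∀ x, (G x)ᶜᶜ ≤ G x) ∧ ∀ x, (G xᶜ)ᶜ ≤ G x := by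
  obtain ⟨G, hFG, hG⟩ := zorn_le_nonempty₀ {G : (ℕ → L) → L | IsValuedFilter G}
    (fun c hc hch y hy => ⟨sSup c, sSup_chain ⟨y, hy⟩ hch hc, fun z hz => le_sSup hz⟩) F hF
  refine ⟨G, hFG, hG.1, fun x => ?_, fun x => ?_⟩
  -- Double negation and adjoining `x` both yield valued filters above the maximal `G`, so neither
  -- can increase any of its values.
  · exact hG.2 (compl_compl hG.1) (fun x => le_compl_compl) x
  · refine le_trans ?_ (hG.2 (adjoin hG.1 x) (fun x => le_sup_left) x)
    refine le_sup_of_le_right (le_inf le_rfl ?_)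
    rw [himp_self]
    exact le_top.trans (hG.1.le_const ⊤)

end Frame

variable {P : Type u} [Preorder P] {F : (ℕ → LowerSet P) → LowerSet P} {p : P}

theorem _root_.LowerSet.mem_compl_iff_forall_notMem {a : LowerSet P} :
    p ∈ aᶜ ↔ ∀ q ≤ p, q ∉ a := by
  rw [← LowerSet.Iic_le, le_compl_iff_disjoint_right, disjoint_iff_inf_le]
  constructor
  · exact fun h q hq ha => h ⟨hq, ha⟩
  · exact fun h q hq => h q hq.1 hq.2

/-- A valued filter is local: meeting `x` with the constant sequence `Iic p` loses nothing at `p`,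
so only what happens below `p` matters. -/
theorem mem_of_local (hF : IsValuedFilter F) {x y : ℕ → LowerSet P} (hx : p ∈ F x)
    (h : ∀ n, ∀ q ≤ p, q ∈ x n → q ∈ y n) : p ∈ F y :=
  hF.mono (a := x ⊓ fun _ => LowerSet.Iic p) (fun n q hq => h n q hq.2 hq.1)
    (hF.inf_le _ _ ⟨hx, hF.le_const _ le_rfl⟩)

theorem mem_of_dense (hreg : ∀ x, (F x)ᶜᶜ ≤ F x) {x : ℕ → LowerSet P}
    (h : ∀ q ≤ p, ∃ r ≤ q, r ∈ F x) : p ∈ F x := by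
  refine hreg x (LowerSet.mem_compl_iff_forall_notMem.2 fun q hq hc => ?_)
  obtain ⟨r, hr, hx⟩ := h q hq
  exact LowerSet.mem_compl_iff_forall_notMem.1 hc r hr hx

end IsValuedFilter

/-! ### From valued ultrafilters to names of ultrafilters -/

namespace PName

variable {P : Type u}

section Preorder

variable [Preorder P]

/-- The name of a family of subsets of `ω` described by a valued filter. -/
def ofFilter (F : (ℕ → LowerSet P) → LowerSet P) : PName P :=
  mk (Σ σ : ℕ → LowerSet P, F σ) (fun i => nice i.1) (fun i => i.2)

variable {F : (ℕ → LowerSet P) → LowerSet P} {x : PName P} {p : P}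

theorem mem_ofFilter (hF : IsValuedFilter F) (hreg : ∀ x, (F x)ᶜᶜ ≤ F x) :
    x.mem (ofFilter F) p ↔ FSentence.sub x (omegaName P) p ∧ p ∈ F x.val := by
  constructor
  · intro h
    have h' : ∀ q ≤ p, ∃ r ≤ q, FSentence.sub x (omegaName P) r ∧ r ∈ F x.val := by
      intro q hq
      obtain ⟨r, hr, ⟨σ, s, hs⟩, hrs, he⟩ := h q hq
      refine ⟨r, hr, fun z t ht hz => ?_, ?_⟩
      · exact nice_sub_omegaName σ t z t le_rfl (mem_congr_right (eq_mono he ht) hz)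
      · refine hF.mem_of_local ((F σ).lower hrs hs) fun n t ht hn => ?_
        exact mem_congr_right (eq_symm (eq_mono he ht)) (le_val_nice σ n hn)
    refine ⟨sub_of_dense fun q hq => ?_, IsValuedFilter.mem_of_dense hreg fun q hq => ?_⟩
    · obtain ⟨r, hr, h₁, -⟩ := h' q hq
      exact ⟨r, hr, h₁⟩
    · obtain ⟨r, hr, -, h₂⟩ := h' q hq
      exact ⟨r, hr, h₂⟩
  · rintro ⟨hsub, hx⟩ q hq
    exact ⟨q, le_rfl, ⟨x.val, ⟨p, hx⟩⟩, hq, eq_mono (eq_nice_val hsub) hq⟩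

theorem isUltrafilterNameExtending_ofFilter (hF : IsValuedFilter F)
    (hreg : ∀ x, (F x)ᶜᶜ ≤ F x) (hult : ∀ x, (F xᶜ)ᶜ ≤ F x) {D : Ultrafilter ℕ}
    (hD : IsNonprincipal D)
    (hDF : ∀ X ∈ D, ∀ σ : ℕ → LowerSet P, (∀ n ∈ X, σ n = ⊤) → F σ = ⊤) :
    IsUltrafilterNameExtending D (ofFilter F) := by
  have hbot : ∀ {x : PName P} {p : P}, p ∈ F x.val →
      (∀ n, ∀ q ≤ p, ¬ (check P (PSet.ofNat n)).mem x q) → False := by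
    intro x p hx h
    have := hF.mem_of_local (y := ⊥) hx fun n q hq hn => (h n q hq hn).elim
    rw [hF.bot_eq] at this
    exact this
  intro p
  refine ⟨⟨?_, ?_, ?_, ?_, ?_, ?_, ?_⟩, ?_⟩
  · exact fun x q _ hx => ((mem_ofFilter hF hreg).1 hx).1
  · refine (mem_ofFilter hF hreg).2 ⟨fun z q _ hz => hz, ?_⟩
    rw [hDF Set.univ Filter.univ_mem _ fun n _ => ?_]
    · trivial
    · exact LowerSet.ext (Set.eq_univ_of_forall fun q =>
        numeral_mem_check_natPSet (Set.mem_univ n))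
  · intro q _ hq
    refine hbot ((mem_ofFilter hF hreg).1 hq).2 fun n r hr hn => ?_
    obtain ⟨s, -, ⟨i, -⟩, -⟩ := hn r le_rfl
    exact i.elim
  · intro x y q _ hx r hr hxy s hs hy
    refine (mem_ofFilter hF hreg).2 ⟨hy, ?_⟩
    refine hF.mem_of_local ((mem_ofFilter hF hreg).1 (mem_mono hx (hs.trans hr))).2 ?_
    exact fun n t ht hn => hxy _ t (ht.trans hs) hn
  · intro x y z q _ hx r hr hy s hs hz
    obtain ⟨hx₁, hx₂⟩ := (mem_ofFilter hF hreg).1 (mem_mono hx (hs.trans hr))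
    obtain ⟨hy₁, hy₂⟩ := (mem_ofFilter hF hreg).1 (mem_mono hy hs)
    refine (mem_ofFilter hF hreg).2 ⟨fun w t ht hw => ?_, ?_⟩
    · exact hx₁ w t ht ((hz w).1 t ht hw).1
    · refine hF.mem_of_local (hF.inf_le _ _ ⟨hx₂, hy₂⟩) fun n t ht hn => ?_
      exact (hz _).2 t ht hn
  · intro x y q _ hx r hr hy s hs
    have hyω : ∀ t ≤ r, FSentence.sub y (omegaName P) t := fun t ht w u hu hw =>
      ((hy w).1 u (hu.trans ht) hw).1
    -- Either some extension of `s` puts the complement into the filter, or `s` lies in `(F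
    -- x.valᶜ)ᶜ`, where the ultrafilter property applies.
    by_cases h : ∃ t ≤ s, t ∈ F x.valᶜ
    · obtain ⟨t, ht, hxc⟩ := h
      refine ⟨t, ht, Or.inr ((mem_ofFilter hF hreg).2 ⟨hyω t (ht.trans hs), ?_⟩)⟩
      refine hF.mem_of_local hxc fun n u hu hn => ?_
      have hur : u ≤ r := hu.trans (ht.trans hs)
      refine (hy _).2 u hur ⟨numeral_mem_check_natPSet (Set.mem_univ n), fun v hv hvx => ?_⟩
      exact LowerSet.mem_compl_iff_forall_notMem.1 hn v hv hvx
    · refine ⟨s, le_rfl, Or.inl ((mem_ofFilter hF hreg).2 ⟨sub_mono hx (hs.trans hr), ?_⟩)⟩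
      exact hult _ (LowerSet.mem_compl_iff_forall_notMem.2 fun t ht hc => h ⟨t, ht, hc⟩)
  · intro n x q _ hn r hr hx s hs hxU
    obtain ⟨t, ht, k, he⟩ := mem_omegaName.1 hn s (hs.trans hr)
    -- Nonprincipality of `D` gives the complement of `{k}` the value `⊤`; its meet with a name of
    -- `{k}` is empty, contradicting properness.
    have hk : ({k}ᶜ : Set ℕ) ∈ D := Ultrafilter.compl_mem_iff_notMem.2 (hD k)
    have htop := hDF _ hk (fun m => if m = k then ⊥ else ⊤) fun m hm => if_neg hm
    have hxt := ((mem_ofFilter hF hreg).1 (mem_mono hxU ht)).2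
    have := hF.inf_le _ _ ⟨hxt, htop.ge trivial⟩
    have := hF.mem_of_local (y := ⊥) this fun m u hu hm => ?_
    · rw [hF.bot_eq] at this
      exact this
    · obtain ⟨hm₁, hm₂⟩ := hm
      have hmn := (hx _).1 u (hu.trans (ht.trans hs)) hm₁
      have hmk := PSet.ofNat_equiv_iff.1 (equiv_of_eq_check (eq_trans hmn (eq_mono he hu)))
      simp [hmk] at hm₂
  · intro x q _ hx
    refine mem_of_dense fun r hr => ?_
    obtain ⟨s, hs, ⟨⟨⟨X, hX⟩⟩, c⟩, hc, he⟩ := hx r hr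
    refine ⟨s, hs, mem_congr_left (eq_symm he) ?_⟩
    refine (mem_ofFilter hF hreg).2 ⟨check_natPSet_sub_omegaName X s, ?_⟩
    change s ∈ F (check P (natPSet X)).val
    rw [hDF X hX _ fun n hn => ?_]
    · trivial
    · exact LowerSet.ext (Set.eq_univ_of_forall fun q => numeral_mem_check_natPSet hn)

end Preorder

variable [PartialOrder P]

/-- The valued filter generated by `D` and the sets `{m | q m ∈ Ġ}` for the sequences `q` with
`lim q ∈ Ġ`. -/
def limFilter (D : Ultrafilter ℕ) (Q : Set P) (lim : (ℕ → Q) → P) (x : ℕ → LowerSet P) :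
    LowerSet P where
  carrier := {p | ∃ X ∈ D, ∃ l : List (ℕ → Q), (∀ q ∈ l, p ≤ lim q) ∧
    ∀ m ∈ X, ∀ r ≤ p, (∀ q ∈ l, r ≤ q m) → r ∈ x m}
  lower' := fun _ _ hba ⟨X, hX, l, hl, h⟩ =>
    ⟨X, hX, l, fun q hq => hba.trans (hl q hq), fun m hm r hr => h m hm r (hr.trans hba)⟩

theorem isValuedFilter_limFilter {D : Ultrafilter ℕ} {Q : Set P} {lim : (ℕ → Q) → P}
    (hstar : ∀ n, StarCondition D Q lim n) : IsValuedFilter (limFilter D Q lim) where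
  mono := fun x y hxy p ⟨X, hX, l, hl, h⟩ =>
    ⟨X, hX, l, hl, fun m hm r hr hrl => hxy m (h m hm r hr hrl)⟩
  inf_le := by
    rintro x y p ⟨⟨X, hX, l, hl, h⟩, ⟨Y, hY, k, hk, h'⟩⟩
    refine ⟨X ∩ Y, Filter.inter_mem hX hY, l ++ k, ?_, fun m hm r hr hrl => ⟨?_, ?_⟩⟩
    · intro q hq
      rcases List.mem_append.1 hq with hq | hq
      exacts [hl q hq, hk q hq]
    · exact h m hm.1 r hr fun q hq => hrl q (List.mem_append_left _ hq)
    · exact h' m hm.2 r hr fun q hq => hrl q (List.mem_append_right _ hq)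
  le_const := fun b p hp =>
    ⟨Set.univ, Filter.univ_mem, [], by simp, fun m _ r hr _ => b.lower hr hp⟩
  bot_eq := by
    refine le_bot_iff.1 ?_
    rintro p ⟨X, hX, l, hl, h⟩
    -- Properness is where the star condition enters: it supplies an index in `X` and a common
    -- extension of `p` and the listed terms, which would have to lie in `⊥`.
    have hs := hstar l.length (fun j => l.get j) p fun j => hl _ (l.get_mem j)
    obtain ⟨m, hm, e, he, hej⟩ := D.nonempty_of_mem (Filter.inter_mem hX hs)
    refine (h m hm e he fun q hq => ?_).elim
    obtain ⟨j, rfl⟩ := List.get_of_mem hq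
    exact hej j

/-- If `lim` satisfies `(⋆)_n` for all `n`, then it witnesses that `Q` is `D`-lim-linked. -/
theorem witnessesLimLinked_of_star {D : Ultrafilter ℕ} (hD : IsNonprincipal D) {Q : Set P}
    {lim : (ℕ → Q) → P} (hstar : ∀ n, StarCondition D Q lim n) :
    WitnessesLimLinked D Q lim := by
  obtain ⟨F, hle, hF, hreg, hult⟩ := (isValuedFilter_limFilter hstar).exists_ultra
  refine ⟨ofFilter F, isUltrafilterNameExtending_ofFilter hF hreg hult hD ?_, fun q => ?_⟩
  · refine fun X hX σ hσ => top_le_iff.1 (le_trans ?_ (hle σ))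
    refine fun p _ => ⟨X, hX, [], by simp, fun m hm r _ _ => ?_⟩
    rw [hσ m hm]
    trivial
  · refine (mem_ofFilter hF hreg).2 ⟨indexName_sub_omegaName _ _, hle _ ?_⟩
    refine ⟨Set.univ, Filter.univ_mem, [q], by simp, fun m _ r _ hr => ?_⟩
    have hrm : r ≤ q m := hr q (by simp)
    refine mem_val.2 (mem_indexName.2 fun s hs => ⟨s, le_rfl, m, ?_, eq_refl _ _⟩)
    exact hs.trans hrm

end PName

/-! ### Norms and intersections of trees -/

namespace ETilde

theorem two_pow_le_a (h : ℕ) : 2 ^ (h + 2) ≤ a h := by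
  refine Nat.pow_le_pow_left ?_ _
  have h1 : 2 ≤ rhoAux (level h).card h := le_max_of_le_right (by omega)
  have h2 : 2 ≤ rhoAux (level h).card h ^ (h + 1) := h1.trans (Nat.le_self_pow (by omega) _)
  have h3 : 2 ≤ (h + 1) ^ 2 * rhoAux (level h).card h ^ (h + 1) := by nlinarith [Nat.zero_le h]
  exact h3.trans (Nat.le_self_pow (pow_pos (by omega) _).ne' _)

theorem two_le_a (h : ℕ) : 2 ≤ a h :=
  (Nat.le_self_pow (by omega) 2).trans (two_pow_le_a h)

theorem M_eq (h : ℕ) : M h = a h ^ 2 := rfl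

/-- As $M=a^2$, the norm bound says that at most $a^{1-1/k}$ successors are missing; taking $k$-th
powers makes this arithmetic in ℕ. For `n ≥ M h` truncated subtraction gives 0, matching norm ∞. -/
theorem one_add_inv_le_muHeight_iff {h n k : ℕ} (hk : 1 ≤ k) :
    1 + (k : ℝ≥0∞)⁻¹ ≤ muHeight h n ↔ (M h - n) ^ k ≤ a h ^ (k - 1) := by
  unfold muHeight
  split_ifs with hn
  · obtain ⟨x, hx⟩ := Nat.exists_eq_add_of_lt hn
    have ha : (1 : ℝ) < a h := by exact_mod_cast two_le_a h
    have ha0 : (0 : ℝ) < a h := by linarith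
    have hk0 : (0 : ℝ) < k := by exact_mod_cast hk
    have hMn : M h - n = x + 1 := by omega
    have hM : (M h : ℝ) = a h ^ 2 := by rw [M_eq]; push_cast; rfl
    have hsub : (M h : ℝ) - n = ((x + 1 : ℕ) : ℝ) := by rw [hx]; push_cast; ring
    have hx0 : (0 : ℝ) < ((x + 1 : ℕ) : ℝ) := by positivity
    have hl : (1 : ℝ≥0∞) + (k : ℝ≥0∞)⁻¹ = ENNReal.ofReal (1 + (k : ℝ)⁻¹) := by
      rw [ENNReal.ofReal_add zero_le_one (by positivity), ENNReal.ofReal_one,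
        ENNReal.ofReal_inv_of_pos hk0, ENNReal.ofReal_natCast]
    rw [hMn, hl, hsub, hM]
    have hpos : (0 : ℝ) < 1 + (k : ℝ)⁻¹ := by positivity
    rw [ENNReal.ofReal_le_ofReal_iff', or_iff_left (not_le.2 hpos),
      Real.le_logb_iff_rpow_le ha (by positivity), le_div_iff₀ hx0,
      ← pow_le_pow_iff_left₀ (by positivity) (by positivity) (by omega : k ≠ 0), mul_pow,
      ← Real.rpow_mul_natCast ha0.le, add_mul, inv_mul_cancel₀ hk0.ne', one_mul,
      Real.rpow_add_one ha0.ne', Real.rpow_natCast]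
    obtain ⟨j, rfl⟩ := Nat.exists_eq_add_of_le' hk
    rw [Nat.add_sub_cancel]
    have e : ((a h : ℝ) ^ 2) ^ (j + 1) = a h ^ (j + 1) * a h * a h ^ j := by ring
    rw [e, mul_le_mul_iff_right₀ (by positivity)]
    exact_mod_cast Iff.rfl
  · simp [Nat.sub_eq_zero_of_le (not_lt.1 hn), zero_pow (by omega : k ≠ 0)]

theorem one_add_inv_mono {k l : ℕ} (h : k ≤ l) :
    1 + (l : ℝ≥0∞)⁻¹ ≤ 1 + (k : ℝ≥0∞)⁻¹ :=
  add_le_add_right (ENNReal.inv_le_inv.2 (by exact_mod_cast h)) _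

theorem nil_mem_Tstar : [] ∈ Tstar := by simp [Tstar, level]

theorem append_singleton_mem_Tstar {s : List ℕ} {l : ℕ} :
    s ++ [l] ∈ Tstar ↔ s ∈ Tstar ∧ l < M s.length := by
  simp only [Tstar, Set.mem_ofPred_eq, List.length_append, List.length_singleton, level,
    Finset.mem_biUnion, Finset.mem_image, Finset.mem_range]
  constructor
  · rintro ⟨s', hs', l', hl', he⟩
    obtain ⟨rfl, rfl⟩ := List.append_singleton_inj.1 he
    exact ⟨hs', hl'⟩
  · rintro ⟨hs, hl⟩
    exact ⟨s, hs, l, hl, rfl⟩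

theorem succs_Tstar {s : List ℕ} (hs : s ∈ Tstar) :
    succs Tstar s = (fun l => s ++ [l]) '' Finset.range (M s.length) := by
  ext u
  constructor
  · rintro ⟨hu, l, rfl⟩
    exact ⟨l, by simpa using (append_singleton_mem_Tstar.1 hu).2, rfl⟩
  · rintro ⟨l, hl, rfl⟩
    exact ⟨append_singleton_mem_Tstar.2 ⟨hs, by simpa using hl⟩, l, rfl⟩

theorem finite_succs_Tstar {s : List ℕ} (hs : s ∈ Tstar) : (succs Tstar s).Finite := by
  rw [succs_Tstar hs]
  exact (Finset.finite_toSet _).image _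

theorem ncard_succs_Tstar {s : List ℕ} (hs : s ∈ Tstar) :
    (succs Tstar s).ncard = M s.length := by
  rw [succs_Tstar hs, Set.ncard_image_of_injective _ fun l l' h => by simpa using h,
    Set.ncard_coe_finset, Finset.card_range]

theorem succs_mono {p q : Set (List ℕ)} (h : p ⊆ q) (s : List ℕ) : succs p s ⊆ succs q s :=
  fun _ hu => ⟨h hu.1, hu.2⟩

theorem ncard_succs_Tstar_diff {p : Set (List ℕ)} (hp : p ⊆ Tstar) {s : List ℕ}
    (hs : s ∈ Tstar) : (succs Tstar s \ succs p s).ncard = M s.length - (succs p s).ncard := by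
  rw [Set.ncard_sdiff (succs_mono hp s) ((finite_succs_Tstar hs).subset (succs_mono hp s)),
    ncard_succs_Tstar hs]

/-- With at most one successor, at least $a^2-1\ge a$ are missing, more than the $a^{1-1/k}$
allowed. -/
theorem nontrivial_succs {p : Set (List ℕ)} {s : List ℕ} {k : ℕ} (hk : 1 ≤ k)
    (h : 1 + (k : ℝ≥0∞)⁻¹ ≤ mu s p) : (succs p s).Nontrivial := by
  rw [mu, one_add_inv_le_muHeight_iff hk] at h
  by_contra hn
  have hle : (succs p s).ncard ≤ 1 := by
    rcases (Set.not_nontrivial_iff.1 hn).eq_empty_or_singleton with he | ⟨x, he⟩ <;> simp [he]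
  have ha := two_le_a s.length
  have hM : a s.length ≤ M s.length - (succs p s).ncard := by
    refine Nat.le_sub_of_add_le ?_
    rw [M_eq]
    nlinarith
  have h' := (Nat.pow_le_pow_left hM k).trans h
  rw [Nat.pow_le_pow_iff_right ha] at h'
  omega

theorem IsSubtree.iInter {ι : Type*} [Nonempty ι] {p : ι → Set (List ℕ)}
    (hp : ∀ i, IsSubtree (p i)) (hne : (⋂ i, p i).Nonempty) : IsSubtree (⋂ i, p i) :=
  ⟨(Set.iInter_subset _ (Classical.arbitrary ι)).trans (hp _).1, hne, fun s hs t ht =>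
    Set.mem_iInter.2 fun i => (hp i).2.2 s (Set.mem_iInter.1 hs i) t ht⟩

/-- With $N$ trees, at most $N a^{1-1/k}$ successors are missing from the intersection, and $N\le
a^{1/(2k)}$ turns this into $a^{1-1/(2k)}$. -/
theorem one_add_inv_le_mu_iInter {ι : Type*} [Fintype ι] [Nonempty ι] {p : ι → Set (List ℕ)}
    (hp : ∀ i, p i ⊆ Tstar) {s : List ℕ} (hs : s ∈ Tstar) {k : ℕ} (hk : 1 ≤ k)
    (h : ∀ i, 1 + (k : ℝ≥0∞)⁻¹ ≤ mu s (p i))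
    (hcard : Fintype.card ι ^ (2 * k) ≤ a s.length) :
    1 + ((2 * k : ℕ) : ℝ≥0∞)⁻¹ ≤ mu s (⋂ i, p i) := by
  have hsub : (⋂ i, p i) ⊆ Tstar := (Set.iInter_subset _ (Classical.arbitrary ι)).trans (hp _)
  simp only [mu, one_add_inv_le_muHeight_iff hk] at h
  rw [mu, one_add_inv_le_muHeight_iff (by omega), ← ncard_succs_Tstar_diff hsub hs]
  obtain ⟨i, hi⟩ := Finite.exists_max fun i => M s.length - (succs (p i) s).ncard
  have hun : succs Tstar s \ succs (⋂ i, p i) s ⊆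
      ⋃ i ∈ (Finset.univ : Finset ι), succs Tstar s \ succs (p i) s := by
    rintro u ⟨hu, hn⟩
    by_contra hc
    simp only [Finset.mem_univ, Set.iUnion_true, Set.mem_iUnion, Set.mem_sdiff, not_exists,
      not_and, not_not] at hc
    exact hn ⟨Set.mem_iInter.2 fun i => (hc i hu).1, hu.2⟩
  have hle : (succs Tstar s \ succs (⋂ i, p i) s).ncard ≤
      Fintype.card ι * (M s.length - (succs (p i) s).ncard) := by
    refine (Set.ncard_le_ncard hun ((Finset.finite_toSet _).biUnion fun i _ =>
      (finite_succs_Tstar hs).sdiff)).trans ?_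
    refine (Finset.set_ncard_biUnion_le _ _).trans ?_
    refine (Finset.sum_le_card_nsmul _ _ _ fun j _ => ?_)
    rw [ncard_succs_Tstar_diff (hp j) hs]
    exact hi j
  calc _ ≤ (Fintype.card ι * (M s.length - (succs (p i) s).ncard)) ^ (2 * k) :=
        Nat.pow_le_pow_left hle _
    _ = Fintype.card ι ^ (2 * k) * ((M s.length - (succs (p i) s).ncard) ^ k) ^ 2 := by
        rw [mul_pow, ← pow_mul, mul_comm k 2]
    _ ≤ a s.length * (a s.length ^ (k - 1)) ^ 2 :=
        Nat.mul_le_mul hcard (Nat.pow_le_pow_left (h i) 2)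
    _ = a s.length ^ (2 * k - 1) := by
        rw [← pow_mul, ← pow_succ']
        congr 1
        omega

/-! ### Restricting a tree to a node -/

/-- The nodes of `p` comparable with `t`. -/
def restrict (p : Set (List ℕ)) (t : List ℕ) : Set (List ℕ) := {s ∈ p | s <+: t ∨ t <+: s}

theorem succs_restrict {p : Set (List ℕ)} {s t : List ℕ} (h : t <+: s) :
    succs (restrict p t) s = succs p s := by
  refine (succs_mono (fun _ hu => hu.1) s).antisymm ?_
  rintro _ ⟨hu, l, rfl⟩
  exact ⟨⟨hu, Or.inr (h.trans (List.prefix_append _ _))⟩, l, rfl⟩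

theorem mu_restrict {p : Set (List ℕ)} {s t : List ℕ} (h : t <+: s) :
    mu s (restrict p t) = mu s p := by
  rw [mu, succs_restrict h, mu]

theorem IsSubtree.restrict {p : Set (List ℕ)} (hp : IsSubtree p) {t : List ℕ} (ht : t ∈ p) :
    IsSubtree (restrict p t) := by
  refine ⟨fun s hs => hp.1 hs.1, ⟨t, ht, Or.inl List.prefix_rfl⟩, ?_⟩
  rintro s ⟨hs, hst⟩ u hu
  refine ⟨hp.2.2 s hs u hu, ?_⟩
  rcases hst with hst | hst
  · exact Or.inl (hu.trans hst)
  · exact List.prefix_or_prefix_of_prefix hu hst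

theorem isStem_restrict {p : Set (List ℕ)} {t : List ℕ} (ht : t ∈ p)
    (hsplit : (succs p t).Nontrivial) : IsStem (restrict p t) t := by
  refine ⟨⟨⟨ht, Or.inl List.prefix_rfl⟩, by rwa [succs_restrict List.prefix_rfl]⟩, ?_⟩
  rintro s ⟨⟨-, hs | hs⟩, hn⟩
  · by_contra hts
    have hlt : s.length < t.length := by
      refine lt_of_le_of_ne hs.length_le fun he => hts ?_
      rw [hs.eq_of_length he]
    refine Set.not_subsingleton_iff.2 hn ?_
    -- A node properly below `t` cannot split: its successors in the restriction are initial
    -- segments of `t` of the same length.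
    have key : ∀ u ∈ succs (restrict p t) s, u <+: t := by
      rintro _ ⟨⟨-, h | h⟩, l, rfl⟩
      · exact h
      · rw [h.eq_of_length (le_antisymm h.length_le (by simpa using hlt))]
    rintro u hu v hv
    have hl : u.length = v.length := by
      obtain ⟨-, l, rfl⟩ := hu
      obtain ⟨-, l', rfl⟩ := hv
      simp
    exact (List.prefix_of_prefix_length_le (key u hu) (key v hv) hl.le).eq_of_length hl
  · exact hs

theorem exists_long_extension {p : Set (List ℕ)} {t : List ℕ} (ht : t ∈ p)
    (h : ∀ s ∈ p, t <+: s → (succs p s).Nonempty) (n : ℕ) :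
    ∃ s ∈ p, t <+: s ∧ n ≤ s.length := by
  induction n with
  | zero => exact ⟨t, ht, List.prefix_rfl, Nat.zero_le _⟩
  | succ n ih =>
    obtain ⟨s, hs, hts, hn⟩ := ih
    obtain ⟨_, hu, l, rfl⟩ := h s hs hts
    exact ⟨_, hu, hts.trans (List.prefix_append _ _), by simpa using hn⟩

/-- The restriction of `p` to `t`, as a condition with stem `t`. -/
theorem isCondition_restrict {p : Set (List ℕ)} (hp : IsSubtree p) {t : List ℕ} (ht : t ∈ p)
    {k : ℕ} (hk : 1 ≤ k) (hkt : k ≤ t.length)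
    (h : ∀ s ∈ p, t <+: s → 1 + (k : ℝ≥0∞)⁻¹ ≤ mu s p) : IsCondition (restrict p t) :=
  ⟨hp.restrict ht, t, isStem_restrict ht (nontrivial_succs hk (h t ht List.prefix_rfl)),
    fun s hs hts => (one_add_inv_mono hkt).trans ((h s hs.1 hts).trans (mu_restrict hts).ge)⟩

end ETilde

/-! ### Limit trees -/

namespace ETilde

section Limit

variable {D : Ultrafilter ℕ} {q : ℕ → ETilde}

/-- Only finitely many successors are possible in `Tstar`, and `D` decides each of them. -/
theorem eventually_succs_limitTree_eq (s : List ℕ) (hs : s ∈ Tstar) :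
    ∀ᶠ m in (D : Filter ℕ), succs (limitTree D q) s = succs (q m).1 s := by
  have h : ∀ᶠ m in (D : Filter ℕ), ∀ u ∈ succs Tstar s, u ∈ limitTree D q ↔ u ∈ (q m).1 := by
    refine (Filter.eventually_all_finite (finite_succs_Tstar hs)).2 fun u hu => ?_
    by_cases hm : {m : ℕ | u ∈ (q m).1} ∈ D
    · exact Filter.mem_of_superset hm fun m hm' => iff_of_true ⟨hu.1, hm⟩ hm'
    · exact Filter.mem_of_superset (Ultrafilter.compl_mem_iff_notMem.2 hm) fun m hm' =>
        iff_of_false (fun hc => hm hc.2) hm'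
  filter_upwards [h] with m hm
  ext u
  constructor
  · exact fun hu => ⟨(hm u ⟨hu.1.1, hu.2⟩).1 hu.1, hu.2⟩
  · intro hu
    have huT := (q m).2.1.1 hu.1
    exact ⟨(hm u ⟨huT, hu.2⟩).2 hu.1, hu.2⟩

theorem isSubtree_limitTree : IsSubtree (limitTree D q) := by
  refine ⟨fun s hs => hs.1, ⟨[], nil_mem_Tstar, Filter.mem_of_superset Filter.univ_mem ?_⟩, ?_⟩
  · intro m _
    obtain ⟨s, hs⟩ := (q m).2.1.2.1
    exact (q m).2.1.2.2 s hs [] List.nil_prefix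
  · intro s hs u hu
    have hmem : ∀ m, s ∈ (q m).1 → u ∈ (q m).1 := fun m hm => (q m).2.1.2.2 s hm u hu
    obtain ⟨m, hm⟩ := D.nonempty_of_mem hs.2
    exact ⟨(q m).2.1.1 (hmem m hm), Filter.mem_of_superset hs.2 hmem⟩

theorem isStem_limitTree {t : List ℕ} (h : ∀ m, IsStem (q m).1 t) :
    IsStem (limitTree D q) t := by
  have htT : t ∈ Tstar := (q 0).2.1.1 (h 0).1.1
  refine ⟨⟨⟨htT, Filter.mem_of_superset Filter.univ_mem fun m _ => (h m).1.1⟩, ?_⟩, ?_⟩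
  · obtain ⟨m, hm⟩ := (eventually_succs_limitTree_eq (D := D) (q := q) t htT).exists
    rw [hm]
    exact (h m).1.2
  · rintro s ⟨hs, hn⟩
    obtain ⟨m, hm, hsm⟩ := ((eventually_succs_limitTree_eq (D := D) (q := q) s hs.1).and
      hs.2).exists
    exact (h m).2 s ⟨hsm, hm ▸ hn⟩

theorem le_mu_limitTree {s : List ℕ} (hs : s ∈ limitTree D q) {c : ℝ≥0∞}
    (h : ∀ m, s ∈ (q m).1 → c ≤ mu s (q m).1) : c ≤ mu s (limitTree D q) := by
  obtain ⟨m, hm, hsm⟩ := ((eventually_succs_limitTree_eq (D := D) (q := q) s hs.1).and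
    hs.2).exists
  rw [mu, hm]
  exact h m hsm

end Limit

/-- All conditions in a component satisfy a common bound on `μ`. -/
theorem exists_uniform_bound {t : List ℕ} {ε : ℚ} {p : ETilde} (hp : p ∈ component t ε) :
    ∃ k : ℕ, 2 ≤ k ∧ 3 * k < t.length ∧ 1 / (k : ℚ) ≤ ε ∧
      ∀ q ∈ component t ε, ∀ s ∈ q.1, t <+: s → 1 + (k : ℝ≥0∞)⁻¹ ≤ mu s q.1 := by
  obtain ⟨m, hm, ⟨-, hmt⟩, -, hε⟩ := hp
  have hmk : m ≤ (t.length - 1) / 3 := by omega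
  -- The witness `m` varies with the condition; this is the largest `k` with `3 * k < t.length`,
  -- hence the weakest of the norm requirements and the smallest `1 / k`.
  refine ⟨(t.length - 1) / 3, by omega, by omega, le_trans ?_ hε, ?_⟩
  · have hm0 : (0 : ℚ) < m := by exact_mod_cast (by omega : 0 < m)
    exact one_div_le_one_div_of_le hm0 (by exact_mod_cast hmk)
  · rintro q ⟨l, -, ⟨-, hlt⟩, hμ, -⟩ s hs hts
    exact (one_add_inv_mono (by omega)).trans (hμ s hs hts)

theorem isStem_of_mem_component {t : List ℕ} {ε : ℚ} {p : ETilde} (hp : p ∈ component t ε) :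
    IsStem p.1 t := hp.choose_spec.2.1.1

theorem le_mu_of_mem_component {t : List ℕ} {ε : ℚ} {p : ETilde} (hp : p ∈ component t ε)
    {s : List ℕ} (hs : s ∈ p.1) (hts : t <+: s) : 1 + (t.length : ℝ≥0∞)⁻¹ ≤ mu s p.1 := by
  obtain ⟨m, -, ⟨-, hmt⟩, hμ, -⟩ := hp
  exact (one_add_inv_mono (by omega)).trans (hμ s hs hts)

variable {t : List ℕ} {ε : ℚ}

theorem isCondition_limitTree (D : Ultrafilter ℕ) (q : ℕ → component t ε) :
    IsCondition (limitTree D fun m => (q m : ETilde)) :=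
  ⟨isSubtree_limitTree, t, isStem_limitTree fun m => isStem_of_mem_component (q m).2,
    fun _ hs hts => le_mu_limitTree hs fun m hm => le_mu_of_mem_component (q m).2 hm hts⟩

/-- The limit operation on a component. -/
def limit (D : Ultrafilter ℕ) (q : ℕ → component t ε) : ETilde :=
  ⟨limitTree D fun m => (q m : ETilde), isCondition_limitTree D q⟩

theorem limit_mem_component (D : Ultrafilter ℕ) (q : ℕ → component t ε) :
    limit D q ∈ component t ε := by
  obtain ⟨k, hk, hkt, hε, hμ⟩ := exists_uniform_bound (q 0).2
  exact ⟨k, hk, ⟨isStem_limitTree fun m => isStem_of_mem_component (q m).2, hkt⟩,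
    fun s hs hts => le_mu_limitTree hs fun m hm => hμ _ (q m).2 s hm hts, hε⟩

theorem exists_node_le (r : ETilde) : ∃ s₀, IsStem r.1 s₀ ∧ ∃ k : ℕ, 1 ≤ k ∧
    (∀ s ∈ r.1, s₀ <+: s → 1 + (k : ℝ≥0∞)⁻¹ ≤ mu s r.1) ∧
    ∀ n : ℕ, ∃ s ∈ r.1, s₀ <+: s ∧ n ≤ s.length := by
  obtain ⟨hr, s₀, hs₀, hμ⟩ := r.2
  have hk : 1 ≤ max s₀.length 1 := le_max_right _ _
  have hμ' : ∀ s ∈ r.1, s₀ <+: s → 1 + ((max s₀.length 1 : ℕ) : ℝ≥0∞)⁻¹ ≤ mu s r.1 :=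
    fun s hs hss => (one_add_inv_mono (le_max_left _ _)).trans (hμ s hs hss)
  exact ⟨s₀, hs₀, _, hk, hμ', exists_long_extension hs₀.1.1 fun s hs hss =>
    (nontrivial_succs hk (hμ' s hs hss)).nonempty⟩

theorem starCondition_limit (D : Ultrafilter ℕ) (n : ℕ) :
    StarCondition D (component t ε) (limit D) n := by
  intro q r hr
  obtain ⟨s₀, hs₀, k, hk, hμ, hlong⟩ := exists_node_le r
  set l := max k t.length with hl
  have hl1 : 1 ≤ l := hk.trans (le_max_left _ _)
  -- Length `2 * l` makes the halved bound sufficient for a condition with stem `s₁`; length `(n +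
  -- 1) ^ (2 * l)` makes `a` large enough to intersect `n + 1` trees.
  obtain ⟨s₁, hs₁, hs₀₁, hlen⟩ := hlong (max (2 * l) ((n + 1) ^ (2 * l)))
  have hev : ∀ j, {m : ℕ | s₁ ∈ (q j m : ETilde).1} ∈ D := fun j => (hr j hs₁).2
  -- The stem `s₀` of `r` also splits the limit trees, whose stem is `t`, so `t` lies below it.
  have ht : ∀ j, t <+: s₁ := fun j => by
    have hsp : IsSplitting (limit D (q j)).1 s₀ :=
      ⟨hr j hs₀.1.1, hs₀.1.2.mono (succs_mono (hr j) s₀)⟩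
    exact ((isStem_of_mem_component (limit_mem_component D (q j))).2 s₀ hsp).trans hs₀₁
  refine Filter.mem_of_superset (Filter.iInter_mem.2 hev) fun m hm => ?_
  rw [Set.mem_iInter] at hm
  let p : Option (Fin n) → Set (List ℕ) := fun i => i.elim r.1 fun j => (q j m : ETilde).1
  have hp : ∀ i, IsSubtree (p i) := by
    rintro (_ | j)
    exacts [r.2.1, (q j m : ETilde).2.1]
  have hmem : s₁ ∈ ⋂ i, p i := by
    refine Set.mem_iInter.2 ?_
    rintro (_ | j)
    exacts [hs₁, hm j]
  have hsub := IsSubtree.iInter hp ⟨s₁, hmem⟩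
  have hW : ∀ s ∈ ⋂ i, p i, s₁ <+: s → 1 + ((2 * l : ℕ) : ℝ≥0∞)⁻¹ ≤ mu s (⋂ i, p i) := by
    intro s hs hs₁s
    have hsi := Set.mem_iInter.1 hs
    refine one_add_inv_le_mu_iInter (fun i => (hp i).1) (hsub.1 hs) hl1 ?_ ?_
    · rintro (_ | j)
      · exact (one_add_inv_mono (le_max_left _ _)).trans
          (hμ s (hsi none) (hs₀₁.trans hs₁s))
      · exact (one_add_inv_mono (le_max_right _ _)).trans
          (le_mu_of_mem_component (q j m).2 (hsi (some j)) ((ht j).trans hs₁s))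
    · rw [Fintype.card_option, Fintype.card_fin]
      calc (n + 1) ^ (2 * l) ≤ s₁.length := (le_max_right _ _).trans hlen
        _ ≤ s.length + 2 := hs₁s.length_le.trans (Nat.le_add_right _ _)
        _ ≤ 2 ^ (s.length + 2) := Nat.lt_two_pow_self.le
        _ ≤ a s.length := two_pow_le_a _
  refine ⟨⟨restrict (⋂ i, p i) s₁, isCondition_restrict hsub hmem (by omega)
    ((le_max_left _ _).trans hlen) hW⟩, ?_, fun j => ?_⟩
  · exact fun s hs => Set.mem_iInter.1 hs.1 none
  · exact fun s hs => Set.mem_iInter.1 hs.1 (some j)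

/-! ### Countably many linked pieces -/

/-- The components are dense. -/
theorem exists_le_mem_component (p : ETilde) : ∃ t, ∃ q ≤ p, q ∈ component t (1 / 2) := by
  obtain ⟨s₀, -, k, hk, hμ, hlong⟩ := exists_node_le p
  set l := max k 2 with hl
  obtain ⟨t, ht, hst, hlen⟩ := hlong (3 * l + 1)
  have h : ∀ s ∈ p.1, t <+: s → 1 + (l : ℝ≥0∞)⁻¹ ≤ mu s p.1 := fun s hs hts =>
    (one_add_inv_mono (le_max_left _ _)).trans (hμ s hs (hst.trans hts))
  have hl2 : 2 ≤ l := le_max_right _ _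
  have hstem := isStem_restrict ht (nontrivial_succs (by omega) (h t ht List.prefix_rfl))
  refine ⟨t, ⟨restrict p.1 t, isCondition_restrict p.2.1 ht (by omega) (by omega) h⟩,
    fun s hs => hs.1, l, hl2, ⟨hstem, hlen⟩, ?_, ?_⟩
  · exact fun s hs hts => (h s hs.1 hts).trans (mu_restrict hts).ge
  · exact one_div_le_one_div_of_le two_pos (by exact_mod_cast hl2)

/-- Replace each term by a member of the component below it and take the limit of these; a common
extension with the smaller terms also extends the original ones. -/
theorem upperClosure_component_mem_lambdaLimCuf (t : List ℕ) (ε : ℚ) :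
    (upperClosure (component t ε) : Set ETilde) ∈ lambdaLimCuf ETilde := by
  intro D hD
  choose f hf hle using fun p : (upperClosure (component t ε) : Set ETilde) =>
    mem_upperClosure.1 p.2
  refine ⟨fun q => limit D fun m => ⟨f (q m), hf (q m)⟩, ?_, ?_⟩
  · refine PName.witnessesLimLinked_of_star hD fun n q r hr => ?_
    refine Filter.mem_of_superset
      (starCondition_limit D n (fun j m => ⟨f (q j m), hf (q j m)⟩) r hr) ?_
    rintro m ⟨e, her, he⟩
    exact ⟨e, her, fun j => (he j).trans (hle (q j m))⟩
  · rintro _ ⟨q, rfl⟩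
    exact subset_upperClosure (limit_mem_component D _)

end ETilde

theorem mainTheorem1 :
    (∀ t ∈ ETilde.Tstar, ∀ ε : ℚ, 0 < ε → ε < 1 →
      ETilde.component t ε ∈ lambdaLimCuf ETilde ∧
      ∀ D : Ultrafilter ℕ, IsNonprincipal D →
        ∃ lim : (ℕ → ETilde.component t ε) → ETilde,
          (∀ q, (lim q).1 = ETilde.limitTree D fun m => (q m : ETilde)) ∧
          (∀ q, lim q ∈ ETilde.component t ε) ∧
          (∀ n : ℕ, StarCondition D (ETilde.component t ε) lim n) ∧
          WitnessesLimLinked D (ETilde.component t ε) lim) ∧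
    IsClassLinked Cardinal.aleph0 lambdaLimCuf ETilde := by
  have hw : ∀ (t : List ℕ) (ε : ℚ) (D : Ultrafilter ℕ), IsNonprincipal D →
      WitnessesLimLinked D (ETilde.component t ε) (ETilde.limit D) := fun t ε D hD =>
    PName.witnessesLimLinked_of_star hD (ETilde.starCondition_limit D)
  refine ⟨fun t _ ε _ _ => ⟨fun D hD => ⟨ETilde.limit D, hw t ε D hD, ?_⟩, fun D hD =>
    ⟨ETilde.limit D, fun _ => rfl, ETilde.limit_mem_component D, ETilde.starCondition_limit D,
      hw t ε D hD⟩⟩, ?_⟩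
  · rintro _ ⟨q, rfl⟩
    exact ETilde.limit_mem_component D q
  · refine ⟨Set.range fun t : List ℕ =>
      (upperClosure (ETilde.component t (1 / 2)) : Set ETilde), ?_, ?_, ?_⟩
    · exact Set.Countable.le_aleph0 (Set.countable_range _)
    · rintro _ ⟨t, rfl⟩
      exact ETilde.upperClosure_component_mem_lambdaLimCuf t _
    · refine Set.eq_univ_of_forall fun p => ?_
      obtain ⟨t, q, hqp, hq⟩ := ETilde.exists_le_mem_component p
      exact ⟨_, ⟨t, rfl⟩, mem_upperClosure.2 ⟨q, hq, hqp⟩⟩
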